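/- Let $r$ be a positive integer and let $u_1 < \dots < u_r$ be $r$ primary colours. For $1 \le i \le 2^r-1$ let $\tilde u_i := u_1^{\epsilon_1(i)} \cdots u_r^{\epsilon_r(i)}$, where $\epsilon_k(i) = 1$ if $2^{k-1}$ appears in the binary expansion of $i$ and $\epsilon_k(i) = 0$ otherwise; the primary colour $u_k$ appears in $\tilde u_i$ if $\epsilon_k(i) = 1$. These $2^r-1$ colours are ordered by $\tilde u_1 < \dots < \tilde u_{2^r-1}$. Let $v(\tilde u_i)$ (resp. $z(\tilde u_i)$) be the smallest (resp. largest) primary colour appearing in $\tilde u_i$, let $w(\tilde u_i)$ be the number of primary colours appearing in $\tilde u_i$, and let $\delta(\tilde u_i, \tilde u_j) = 1$ if $z(\tilde u_i) < v(\tilde u_j)$ and $0$ otherwise. A coloured overpartition of $n$ into non-negative parts is a finite non-increasing sequence $\lambda_1 + \dots + \lambda_s$ of coloured non-negative integers (ordered by value, and then by colour) whose values sum to $n$, in which the first occurrence of each coloured integer may be overlined. Write $c(\lambda_i)$ for the colour of $\lambda_i$. For $\ell_1, \dots, \ell_r, k, n \ge 0$, let $\overline{A}(\ell_1, \dots, \ell_r;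 k, n)$ be the number of overpartitions of $n$ into non-negative parts coloured $u_1, \dots, u_r$, having $\ell_i$ parts coloured $u_i$ for all $i \in \{1, \dots, r\}$ and $k$ non-overlined parts. Let $\overline{B}(\ell_1, \dots, \ell_r; k, n)$ be the number of overpartitions $\lambda_1 + \dots + \lambda_s$ of $n$ into non-negative parts coloured $\tilde u_1, \dots, \tilde u_{2^r-1}$, such that for all $i \in \{1, \dots, r\}$ exactly $\ell_i$ parts have $u_i$ as one of their primary colours, having $k$ non-overlined parts and satisfying, for $1 \le i < s$, $$\lambda_i - \lambda_{i+1} \ge w(c(\lambda_{i+1})) + \chi(\overline{\lambda_{i+1}}) - 1 + \delta(c(\lambda_i), c(\lambda_{i+1})),$$ where the left-hand side is the difference of the values, and $\chi(\overline{\lambda_{i+1}}) = 1$ if $\lambda_{i+1}$ is overlined and $0$ otherwise. Then both numbers are finite, and for all $\ell_1, \dots, \ell_r, k, n \ge 0$, $$\overline{A}(\ell_1, \dots, \ell_r; k, n) = \overline{B}(\ell_1, \dots, \ell_r; k, n).$$ -/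

import Mathlib

/-- A coloured integer, overlined or not. The value may be `0`. -/
@[ext]
structure ColouredPart (C : Type) where
  value : ℕ
  colour : C
  overlined : Bool

/-- The order on coloured integers: first by value, then by colour. -/
def ColouredPart.Le {C : Type} [LinearOrder C] (p q : ColouredPart C) : Prop :=
  p.value < q.value ∨ (p.value = q.value ∧ p.colour ≤ q.colour)

/-- A coloured overpartition into non-negative parts: a finite non-increasing sequence of coloured
integers, in which only the first occurrence of each coloured integer may be overlined. -/
def IsOverpartition {C : Type} [LinearOrder C] (l : List (ColouredPart C)) : Prop :=
  l.Pairwise (fun p q => q.Le p) ∧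
  l.Pairwise (fun p q => p.value = q.value → p.colour = q.colour → q.overlined = false)

/-- The number partitioned. -/
def partSum {C : Type} (l : List (ColouredPart C)) : ℕ :=
  (l.map ColouredPart.value).sum

/-- The number of non-overlined parts. -/
def nonOverlinedCount {C : Type} (l : List (ColouredPart C)) : ℕ :=
  l.countP (fun p => !p.overlined)

/-- The composite colours, given by their indices in `{1, …, 2 ^ r - 1}`, with the natural order.
The primary colours are the elements of `Fin r` (so `u_k` is the element `k - 1`). -/
abbrev CompositeColour (r : ℕ) : Type := {i : ℕ // 1 ≤ i ∧ i < 2 ^ r}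

/-- The primary colours that appear in a composite colour: those whose power of two appears in the
binary expansion of the index. -/
def CompositeColour.primaries {r : ℕ} (c : CompositeColour r) : Finset (Fin r) :=
  Finset.univ.filter (fun k => Nat.testBit c.1 k = true)

theorem CompositeColour.primaries_nonempty {r : ℕ} (c : CompositeColour r) :
    c.primaries.Nonempty := by
  obtain ⟨k, hk⟩ := Nat.exists_testBit_of_ne_zero (Nat.one_le_iff_ne_zero.mp c.2.1)
  have hlt : k < r := by
    by_contra h
    have h2 : c.1 < 2 ^ k :=
      lt_of_lt_of_le c.2.2 (Nat.pow_le_pow_right (by norm_num) (not_lt.mp h))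
    rw [Nat.testBit_lt_two_pow h2] at hk
    exact Bool.noConfusion hk
  exact ⟨⟨k, hlt⟩, by simp [CompositeColour.primaries, hk]⟩

/-- The smallest primary colour appearing in a composite colour. -/
def CompositeColour.v {r : ℕ} (c : CompositeColour r) : Fin r :=
  c.primaries.min' c.primaries_nonempty

/-- The largest primary colour appearing in a composite colour. -/
def CompositeColour.z {r : ℕ} (c : CompositeColour r) : Fin r :=
  c.primaries.max' c.primaries_nonempty

/-- The number of primary colours appearing in a composite colour. -/
def CompositeColour.w {r : ℕ} (c : CompositeColour r) : ℕ :=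
  c.primaries.card

def CompositeColour.delta {r : ℕ} (c d : CompositeColour r) : ℤ :=
  if c.z < d.v then 1 else 0

def ColouredPart.chi {C : Type} (p : ColouredPart C) : ℤ :=
  if p.overlined = true then 1 else 0

/-- The difference condition on consecutive parts `p = λ_i`, `q = λ_{i+1}`. -/
def DifferenceCondition {r : ℕ} (p q : ColouredPart (CompositeColour r)) : Prop :=
  (p.value : ℤ) - (q.value : ℤ) ≥
    (q.colour.w : ℤ) + q.chi - 1 + CompositeColour.delta p.colour q.colour

/-- The overpartitions of `n` into non-negative parts in the `r` primary colours, with `ℓ i` parts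
of colour `u_i` and `k` non-overlined parts. -/
def primaryOverpartitions (r : ℕ) (ℓ : Fin r → ℕ) (k n : ℕ) : Set (List (ColouredPart (Fin r))) :=
  {l | IsOverpartition l ∧ partSum l = n ∧
    (∀ i : Fin r, l.countP (fun p => decide (p.colour = i)) = ℓ i) ∧
    nonOverlinedCount l = k}

/-- The overpartitions of `n` into non-negative parts in the `2 ^ r - 1` composite colours that
satisfy the difference conditions, with `ℓ i` parts having `u_i` as one of their primary colours
and `k` non-overlined parts. -/
def compositeOverpartitions (r : ℕ) (ℓ : Fin r → ℕ) (k n : ℕ) :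
    Set (List (ColouredPart (CompositeColour r))) :=
  {l | IsOverpartition l ∧ partSum l = n ∧
    (∀ i : Fin r, l.countP (fun p => decide (i ∈ p.colour.primaries)) = ℓ i) ∧
    nonOverlinedCount l = k ∧
    l.IsChain DifferenceCondition}

open PowerSeries
open scoped MvPowerSeries.WithPiTopology PowerSeries.WithPiTopology

variable {C : Type} {r : ℕ}

/-! Write `q` for `X`, and give a list of parts the weight `d` per non-overlined part, `q` to the
sum of its values, and one variable `u_c` per occurrence of a primary colour. For fixed colour
content the generating function is a polynomial in `d` over the domain `ℤ⟦X⟧`, so the refined counts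
agree once the two series agree at the infinitely many points `d = -q^N`.

At such a point the primary product `∏ (1 + u_c q^v) / (1 - d u_c q^v)` telescopes to the finite
product of `1 + u_c q^v` over `v < N`, which is `strictSeries`. Rather than handling the infinite
product, `partsSeries_primary` shows that both series satisfy the same functional equation under
`u_c ↦ q u_c`, which has only one solution with constant term 1.

On the composite side, fix the sequence of colours, smallest part first. Removing the smallest part
gives a recursion with factors `(d + q^j) / (1 - q^(j+1))`. At `d = -q^N` these multiply to the
generating function of the subsets of `{0, ..., N-1}` with as many elements as there are parts,
times a power of `q` from the minimal gaps (`partsSeries_chainsOfColours`). Now spell each colour as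
a decreasing word and concatenate. For a fixed word, the sum over all ways of cutting it into
decreasing blocks satisfies the recurrence of strictly decreasing sequences of pairs (value below
`N`, letter) spelling that word (`wordSeries_succ_cons`). Over all words these sequences are the
finite sets of pairs, so the total is again `strictSeries` (`tsum_wordSeries`). -/

abbrev ColourSeries (r : ℕ) : Type := MvPowerSeries (Fin r) ℤ⟦X⟧


/-! ### Weighted generating series of sets of lists of parts -/

noncomputable def colourContent (κ : C → Fin r →₀ ℕ) (l : List (ColouredPart C)) : Fin r →₀ ℕ :=
  (l.map fun p => κ p.colour).sum

noncomputable def partsTerm (κ : C → Fin r →₀ ℕ) (d : ℤ⟦X⟧) (l : List (ColouredPart C)) :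
    ColourSeries r :=
  MvPowerSeries.monomial (colourContent κ l) (d ^ nonOverlinedCount l * X ^ partSum l)

noncomputable def partsSeries (κ : C → Fin r →₀ ℕ) (d : ℤ⟦X⟧) (S : Set (List (ColouredPart C))) :
    ColourSeries r :=
  ∑' l, S.indicator (partsTerm κ d) l

theorem length_le_degree {κ : C → Fin r →₀ ℕ} (hκ : ∀ c, κ c ≠ 0) (l : List (ColouredPart C)) :
    l.length ≤ (colourContent κ l).degree := by
  induction l with
  | nil => simp
  | cons p l ih =>
    have : 1 ≤ (κ p.colour).degree := by
      rw [Nat.one_le_iff_ne_zero, Ne, Finsupp.degree_eq_zero_iff]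
      exact hκ _
    simp only [colourContent, List.map_cons, List.sum_cons, map_add, List.length_cons] at ih ⊢
    omega

/-- The content bounds the length, because every colour contributes to it, and the sum bounds each
value. This gives summability of all series below: zero parts are harmless because the colour
variables count them. -/
theorem finite_content_le [Finite C] {κ : C → Fin r →₀ ℕ} (hκ : ∀ c, κ c ≠ 0)
    (ℓ : Fin r →₀ ℕ) (n : ℕ) :
    {l : List (ColouredPart C) | colourContent κ l = ℓ ∧ partSum l ≤ n}.Finite := by
  have hf := List.finite_length_le (C × Fin (n + 1) × Bool) ℓ.degree
  refine (hf.image (List.map fun x => (⟨x.2.1, x.1, x.2.2⟩ : ColouredPart C))).subset ?_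
  rintro l ⟨h1, h2⟩
  refine ⟨l.map fun p => (p.colour, Fin.ofNat (n + 1) p.value, p.overlined), ?_, ?_⟩
  · simp only [Set.mem_ofPred_eq, List.length_map]
    exact h1 ▸ length_le_degree hκ l
  · have : ∀ p ∈ l, p.value ≤ n := fun p hp =>
      (List.single_le_sum (by simp) _ (List.mem_map_of_mem hp)).trans h2
    rw [List.map_map]
    conv_rhs => rw [← List.map_id l]
    refine List.map_congr_left fun p hp => ?_
    ext <;> simp [Nat.mod_eq_of_lt (Nat.lt_succ_of_le (this p hp))]

theorem coeff_coeff_partsTerm (κ : C → Fin r →₀ ℕ) (d : ℤ⟦X⟧) (l : List (ColouredPart C))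
    (ℓ : Fin r →₀ ℕ) (n : ℕ)
    (h : PowerSeries.coeff n (MvPowerSeries.coeff ℓ (partsTerm κ d l)) ≠ 0) :
    colourContent κ l = ℓ ∧ partSum l ≤ n := by
  classical
  rw [partsTerm, MvPowerSeries.coeff_monomial] at h
  split_ifs at h with h1
  · refine ⟨h1.symm, ?_⟩
    rw [PowerSeries.coeff_mul_X_pow'] at h
    by_contra h2
    simp [h2] at h
  · simp at h

theorem ColourSeries.summable_of_finite {ι : Type*} {f : ι → ColourSeries r}
    (h : ∀ ℓ n, {i | PowerSeries.coeff n (MvPowerSeries.coeff ℓ (f i)) ≠ 0}.Finite) :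
    Summable f := by
  rw [MvPowerSeries.WithPiTopology.summable_iff_summable_coeff]
  intro ℓ
  rw [PowerSeries.WithPiTopology.summable_iff_summable_coeff]
  intro n
  exact summable_of_hasFiniteSupport (h ℓ n)

theorem summable_partsTerm [Finite C] {κ : C → Fin r →₀ ℕ} (hκ : ∀ c, κ c ≠ 0) (d : ℤ⟦X⟧)
    (S : Set (List (ColouredPart C))) : Summable (S.indicator (partsTerm κ d)) := by
  refine ColourSeries.summable_of_finite fun ℓ n => (finite_content_le hκ ℓ n).subset ?_
  intro l hl
  refine coeff_coeff_partsTerm κ d l ℓ n fun h => hl ?_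
  by_cases hS : l ∈ S <;> simp [hS, h]

theorem partsSeries_union [Finite C] {κ : C → Fin r →₀ ℕ} (hκ : ∀ c, κ c ≠ 0) (d : ℤ⟦X⟧)
    {S T : Set (List (ColouredPart C))} (h : Disjoint S T) :
    partsSeries κ d (S ∪ T) = partsSeries κ d S + partsSeries κ d T := by
  simp only [partsSeries, Set.indicator_union_of_disjoint h]
  exact (summable_partsTerm hκ d S).tsum_add (summable_partsTerm hκ d T)

theorem partsSeries_image [Finite C] {κ : C → Fin r →₀ ℕ} (hκ : ∀ c, κ c ≠ 0) (d : ℤ⟦X⟧)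
    {S : Set (List (ColouredPart C))} {g : List (ColouredPart C) → List (ColouredPart C)}
    (hg : Function.Injective g) (m : ColourSeries r)
    (h : ∀ l ∈ S, partsTerm κ d (g l) = m * partsTerm κ d l) :
    partsSeries κ d (g '' S) = m * partsSeries κ d S := by
  rw [partsSeries, partsSeries, ← (summable_partsTerm hκ d S).tsum_mul_left]
  rw [← hg.tsum_eq]
  · refine tsum_congr fun l => ?_
    by_cases hl : l ∈ S
    · simp [hl, h, hg.mem_set_image]
    · simp [hl, hg.mem_set_image]
  · refine (Function.support_subset_iff'.2 fun x hx => Set.indicator_of_notMem ?_ _)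
    exact fun h => hx (Set.image_subset_range _ _ h)

def shiftParts (t : ℕ) (l : List (ColouredPart C)) : List (ColouredPart C) :=
  l.map fun p => ⟨p.value + t, p.colour, p.overlined⟩

theorem shiftParts_injective (t : ℕ) : Function.Injective (shiftParts (C := C) t) := by
  refine List.map_injective_iff.2 fun p q h => ?_
  simp only [ColouredPart.mk.injEq] at h
  ext <;> simp_all

theorem exists_shiftParts_eq {t : ℕ} {l : List (ColouredPart C)} (h : ∀ p ∈ l, t ≤ p.value) :
    ∃ l', shiftParts t l' = l := by
  refine ⟨l.map fun p => ⟨p.value - t, p.colour, p.overlined⟩, ?_⟩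
  rw [shiftParts, List.map_map]
  conv_rhs => rw [← List.map_id l]
  refine List.map_congr_left fun p hp => ?_
  have := h p hp
  ext <;> simp
  omega

theorem partsTerm_cons (κ : C → Fin r →₀ ℕ) (d : ℤ⟦X⟧) (p : ColouredPart C)
    (l : List (ColouredPart C)) :
    partsTerm κ d (p :: l) = MvPowerSeries.monomial (κ p.colour)
      ((if p.overlined then 1 else d) * X ^ p.value) * partsTerm κ d l := by
  rw [partsTerm, partsTerm, MvPowerSeries.monomial_mul_monomial]
  congr 1
  rcases p with ⟨v, c, o⟩
  cases o <;> simp [nonOverlinedCount, partSum, pow_add] <;> ring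

theorem partsTerm_nil (κ : C → Fin r →₀ ℕ) (d : ℤ⟦X⟧) : partsTerm κ d [] = 1 := by
  simp [partsTerm, colourContent, nonOverlinedCount, partSum]

theorem partsTerm_shiftParts (κ : C → Fin r →₀ ℕ) (d : ℤ⟦X⟧) (t : ℕ)
    (l : List (ColouredPart C)) :
    partsTerm κ d (shiftParts t l) =
      MvPowerSeries.C (X ^ (t * l.length)) * partsTerm κ d l := by
  induction l with
  | nil => simp [shiftParts, partsTerm_nil]
  | cons p l ih =>
    rw [shiftParts, List.map_cons, ← shiftParts, partsTerm_cons, partsTerm_cons, ih]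
    simp only [← mul_assoc, ← MvPowerSeries.monomial_zero_eq_C_apply,
      MvPowerSeries.monomial_mul_monomial, add_zero, zero_add, List.length_cons]
    congr 2
    ring

/-! ### The finite product and the functional equation that determines it -/

noncomputable def strictSeries (r N : ℕ) : ColourSeries r :=
  ∏ v ∈ Finset.range N, ∏ c : Fin r, (1 + MvPowerSeries.C (X ^ v) * MvPowerSeries.X c)

noncomputable def shiftSeries (r : ℕ) : ColourSeries r →+* ColourSeries r :=
  MvPowerSeries.rescale fun _ => X

theorem coeff_shiftSeries (F : ColourSeries r) (ℓ : Fin r →₀ ℕ) :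
    MvPowerSeries.coeff ℓ (shiftSeries r F) = X ^ ℓ.degree * MvPowerSeries.coeff ℓ F := by
  rw [shiftSeries, MvPowerSeries.coeff_rescale, Finsupp.prod, Finset.prod_pow_eq_pow_sum]
  rfl

theorem shiftSeries_strictSeries (N : ℕ) :
    shiftSeries r (strictSeries r N) = ∏ v ∈ Finset.range N, ∏ c : Fin r,
      (1 + MvPowerSeries.C (X ^ (v + 1)) * MvPowerSeries.X c) := by
  classical
  simp only [strictSeries, map_prod, map_add, map_one]
  refine Finset.prod_congr rfl fun v _ => Finset.prod_congr rfl fun c _ => ?_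
  congr 1
  ext1 ℓ
  rw [coeff_shiftSeries, MvPowerSeries.coeff_C_mul, MvPowerSeries.coeff_C_mul,
    MvPowerSeries.coeff_X]
  split_ifs with h
  · simp [h, pow_succ']
  · simp

/-- The substitution `u_c ↦ q u_c` moves the range of `v` from `0, ..., N-1` to `1, ..., N`; both
sides are the product over `0, ..., N`. -/
theorem strictSeries_shift (N : ℕ) :
    (∏ c : Fin r, (1 + MvPowerSeries.C (X ^ N) * MvPowerSeries.X c)) * strictSeries r N =
      (∏ c : Fin r, (1 + MvPowerSeries.X c)) * shiftSeries r (strictSeries r N) := by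
  rw [shiftSeries_strictSeries, strictSeries, mul_comm, ← Finset.prod_range_succ,
    Finset.prod_range_succ', mul_comm]
  simp

theorem coeff_mul_of_lower_eq_zero {P F : ColourSeries r} {ℓ : Fin r →₀ ℕ}
    (h : ∀ ℓ' : Fin r →₀ ℕ, ℓ'.degree < ℓ.degree → MvPowerSeries.coeff ℓ' F = 0) :
    MvPowerSeries.coeff ℓ (P * F) =
      MvPowerSeries.constantCoeff P * MvPowerSeries.coeff ℓ F := by
  classical
  rw [MvPowerSeries.coeff_mul, Finset.sum_eq_single (0, ℓ)]
  · simp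
  · rintro ⟨a, b⟩ hab hne
    rw [Finset.HasAntidiagonal.mem_antidiagonal] at hab
    dsimp only at hab ⊢
    rw [h b, mul_zero]
    have ha : a ≠ 0 := by
      rintro rfl
      simp at hab
      exact hne (by rw [hab])
    have h1 : a.degree ≠ 0 := by rwa [Ne, Finsupp.degree_eq_zero_iff]
    rw [← hab, map_add]
    omega
  · intro hh
    simp at hh

/-- In a lowest degree `m > 0` where `F` could be nonzero, comparing coefficients gives `(1 - q^m)
F_ℓ = 0`, and `1 - q^m` is not zero in a domain. -/
theorem eq_zero_of_shift_eq {P Q F : ColourSeries r} (hP : MvPowerSeries.constantCoeff P = 1)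
    (hQ : MvPowerSeries.constantCoeff Q = 1) (hF : MvPowerSeries.constantCoeff F = 0)
    (h : P * F = Q * shiftSeries r F) : F = 0 := by
  have key : ∀ m, ∀ ℓ : Fin r →₀ ℕ, ℓ.degree = m → MvPowerSeries.coeff ℓ F = 0 := by
    intro m
    induction m using Nat.strong_induction_on with
    | _ m ih =>
      rintro ℓ rfl
      rcases eq_or_ne ℓ 0 with rfl | hℓ
      · simpa using hF
      have hdeg : ℓ.degree ≠ 0 := by rwa [Ne, Finsupp.degree_eq_zero_iff]
      have e := congrArg (MvPowerSeries.coeff ℓ) h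
      rw [coeff_mul_of_lower_eq_zero fun ℓ' hl => ih _ hl _ rfl,
        coeff_mul_of_lower_eq_zero fun ℓ' hl => by rw [coeff_shiftSeries, ih _ hl _ rfl, mul_zero],
        hP, hQ, coeff_shiftSeries, one_mul, one_mul, ← sub_eq_zero, ← one_sub_mul] at e
      refine (mul_eq_zero.1 e).resolve_left fun h0 => ?_
      have := congrArg PowerSeries.constantCoeff h0
      simp [hdeg] at this
  ext1 ℓ
  simpa using key _ ℓ rfl

/-! ### The primary side -/

/-- The order on consecutive parts, read from the smallest part of an overpartition. -/
def AscRel [LinearOrder C] (q p : ColouredPart C) : Prop :=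
  q.Le p ∧ (p.value = q.value → p.colour = q.colour → q.overlined = false)

theorem isOverpartition_iff_reverse [LinearOrder C] (l : List (ColouredPart C)) :
    IsOverpartition l ↔ l.reverse.Pairwise AscRel := by
  rw [List.pairwise_reverse, IsOverpartition, ← List.pairwise_and_iff]
  rfl

def ascFrom (r c : ℕ) : Set (List (ColouredPart (Fin r))) :=
  {l | l.Pairwise AscRel ∧ ∀ p ∈ l, p.value = 0 → c ≤ p.colour}

noncomputable def primaryContent {r : ℕ} (c : Fin r) : Fin r →₀ ℕ := Finsupp.single c 1

theorem primaryContent_ne_zero (c : Fin r) : primaryContent c ≠ 0 := by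
  simp [primaryContent]

/-- Read from the smallest part, the only copy of a coloured integer that may be overlined is the
last one. So after a non-overlined `(0, c)` further copies may follow, while after an overlined one
none can. -/
theorem ascFrom_eq_union (c : Fin r) :
    ascFrom r c = ascFrom r (c + 1) ∪ (List.cons ⟨0, c, false⟩ '' ascFrom r c ∪
      List.cons ⟨0, c, true⟩ '' ascFrom r (c + 1)) := by
  ext l
  simp only [Set.mem_union, Set.mem_image]
  constructor
  · rintro ⟨h1, h2⟩
    cases l with
    | nil => exact Or.inl ⟨h1, by simp⟩
    | cons q l =>
      rw [List.pairwise_cons] at h1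
      by_cases hq : q.value = 0 ∧ q.colour = c
      · obtain ⟨v, c', o⟩ := q
        obtain ⟨rfl, rfl⟩ := hq
        right
        cases o with
        | false =>
          exact Or.inl ⟨l, ⟨h1.2, fun p hp => h2 p (List.mem_cons_of_mem _ hp)⟩, rfl⟩
        | true =>
          refine Or.inr ⟨l, ⟨h1.2, fun p hp hp0 => ?_⟩, rfl⟩
          have h3 := h2 p (List.mem_cons_of_mem _ hp) hp0
          have h4 := (h1.1 p hp).2 hp0
          have h5 : p.colour ≠ c' := fun h => by simpa using h4 h
          have h6 : (p.colour : ℕ) ≠ c' := fun h => h5 (Fin.ext h)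
          exact Nat.succ_le_of_lt (lt_of_le_of_ne h3 (Ne.symm h6))
      · refine Or.inl ⟨List.pairwise_cons.2 h1, fun p hp hp0 => ?_⟩
        have hq0 : q.value = 0 := by
          rcases List.mem_cons.1 hp with rfl | hp
          · exact hp0
          · rcases (h1.1 p hp).1 with h | h <;> omega
        have h3 := h2 q List.mem_cons_self hq0
        have h4 : (q.colour : ℕ) ≠ c := fun h => hq ⟨hq0, Fin.ext h⟩
        rcases List.mem_cons.1 hp with rfl | hp
        · omega
        · rcases (h1.1 p hp).1 with h | h
          · omega
          · have := Fin.le_def.1 h.2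
            omega
  · rintro (⟨h1, h2⟩ | ⟨l, ⟨h1, h2⟩, rfl⟩ | ⟨l, ⟨h1, h2⟩, rfl⟩)
    · exact ⟨h1, fun p hp hp0 => by have := h2 p hp hp0; omega⟩
    · refine ⟨List.pairwise_cons.2 ⟨fun p hp => ⟨?_, fun _ _ => rfl⟩, h1⟩, ?_⟩
      · rcases Nat.eq_zero_or_pos p.value with h | h
        · exact Or.inr ⟨h.symm, h2 p hp h⟩
        · exact Or.inl h
      · rintro p hp hp0
        rcases List.mem_cons.1 hp with rfl | hp
        · exact le_rfl
        · exact h2 p hp hp0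
    · refine ⟨List.pairwise_cons.2 ⟨fun p hp => ⟨?_, fun h h' => ?_⟩, h1⟩, ?_⟩
      · rcases Nat.eq_zero_or_pos p.value with h | h
        · exact Or.inr ⟨h.symm, (Nat.le_succ _).trans (h2 p hp h)⟩
        · exact Or.inl h
      · have := h2 p hp h
        dsimp only at h'
        rw [h'] at this
        omega
      · rintro p hp hp0
        rcases List.mem_cons.1 hp with rfl | hp
        · exact le_rfl
        · exact (Nat.le_succ _).trans (h2 p hp hp0)

theorem partsSeries_ascFrom_succ (d : ℤ⟦X⟧) (c : Fin r) :
    (1 - MvPowerSeries.C d * MvPowerSeries.X c) * partsSeries primaryContent d (ascFrom r c) =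
      (1 + MvPowerSeries.X c) * partsSeries primaryContent d (ascFrom r (c + 1)) := by
  have hd1 : Disjoint (List.cons (⟨0, c, false⟩ : ColouredPart (Fin r)) '' ascFrom r c)
      (List.cons ⟨0, c, true⟩ '' ascFrom r (c + 1)) := by
    rw [Set.disjoint_left]
    rintro _ ⟨l, -, rfl⟩ ⟨l', -, h⟩
    simp at h
  have hd2 : Disjoint (ascFrom r (c + 1)) (List.cons ⟨0, c, false⟩ '' ascFrom r c ∪
      List.cons ⟨0, c, true⟩ '' ascFrom r (c + 1)) := by
    rw [Set.disjoint_left]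
    rintro _ ⟨-, h⟩ (⟨l', -, rfl⟩ | ⟨l', -, rfl⟩) <;>
    · have := h _ List.mem_cons_self rfl
      dsimp only at this
      omega
  have hX : ∀ a : ℤ⟦X⟧, MvPowerSeries.monomial (primaryContent c) a =
      MvPowerSeries.C a * MvPowerSeries.X c := fun a => by
    rw [primaryContent, MvPowerSeries.X, ← MvPowerSeries.monomial_zero_eq_C_apply,
      MvPowerSeries.monomial_mul_monomial, zero_add, mul_one]
  have e := congrArg (partsSeries primaryContent d) (ascFrom_eq_union c)
  rw [partsSeries_union primaryContent_ne_zero d hd2,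
    partsSeries_union primaryContent_ne_zero d hd1,
    partsSeries_image primaryContent_ne_zero d List.cons_injective _
      (fun l _ => partsTerm_cons _ _ _ l),
    partsSeries_image primaryContent_ne_zero d List.cons_injective _
      (fun l _ => partsTerm_cons _ _ _ l), hX, hX] at e
  simp only [pow_zero, mul_one, if_true, map_one, one_mul, Bool.false_eq_true, if_false] at e
  linear_combination e

/-- No colour index reaches `r`, so the bound `r` excludes zero parts altogether. -/
theorem ascFrom_self : ascFrom r r = shiftParts 1 '' ascFrom r 0 := by
  ext l
  constructor
  · rintro ⟨h1, h2⟩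
    have h3 : ∀ p ∈ l, 1 ≤ p.value := fun p hp => by
      have := h2 p hp
      have := p.colour.isLt
      omega
    obtain ⟨l, rfl⟩ := exists_shiftParts_eq h3
    refine ⟨l, ⟨?_, by simp⟩, rfl⟩
    rw [shiftParts, List.pairwise_map] at h1
    refine h1.imp fun h => ⟨?_, fun h' => h.2 (by simpa using h')⟩
    rcases h.1 with h | h
    · exact Or.inl (by simpa using h)
    · exact Or.inr (by simpa using h)
  · rintro ⟨l, ⟨h1, -⟩, rfl⟩
    refine ⟨?_, fun p hp => ?_⟩
    · rw [shiftParts, List.pairwise_map]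
      refine h1.imp fun h => ⟨?_, fun h' => h.2 (by simpa using h')⟩
      rcases h.1 with h | h
      · exact Or.inl (by simpa using h)
      · exact Or.inr (by simpa using h)
    · obtain ⟨p, -, rfl⟩ := List.mem_map.1 hp
      simp

theorem degree_primaryContent (l : List (ColouredPart (Fin r))) :
    (colourContent primaryContent l).degree = l.length := by
  induction l with
  | nil => simp [colourContent]
  | cons p l ih =>
    simp only [colourContent, List.map_cons, List.sum_cons, map_add, List.length_cons] at ih ⊢
    rw [ih, primaryContent, Finsupp.degree_single, add_comm]

theorem partsTerm_shiftParts_one (d : ℤ⟦X⟧) (l : List (ColouredPart (Fin r))) :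
    partsTerm primaryContent d (shiftParts 1 l) = shiftSeries r (partsTerm primaryContent d l) := by
  classical
  ext1 ℓ
  rw [partsTerm_shiftParts, coeff_shiftSeries, MvPowerSeries.coeff_C_mul, partsTerm,
    MvPowerSeries.coeff_monomial, one_mul]
  split_ifs with h
  · rw [h, degree_primaryContent]
  · simp

theorem partsSeries_ascFrom_self (d : ℤ⟦X⟧) :
    partsSeries primaryContent d (ascFrom r r) =
      shiftSeries r (partsSeries primaryContent d (ascFrom r 0)) := by
  have h1 := (summable_partsTerm primaryContent_ne_zero d (ascFrom r 0)).hasSum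
  have h2 : HasSum (fun l => shiftSeries r ((ascFrom r 0).indicator (partsTerm primaryContent d) l))
      (shiftSeries r (partsSeries primaryContent d (ascFrom r 0))) := by
    -- The shift passes through the infinite sum because it multiplies each coefficient by a fixed
    -- power of `X`.
    rw [MvPowerSeries.WithPiTopology.hasSum_iff_hasSum_coeff] at h1 ⊢
    intro ℓ
    simp only [coeff_shiftSeries]
    exact (h1 ℓ).mul_left _
  rw [← h2.tsum_eq, partsSeries, ascFrom_self, ← (shiftParts_injective 1).tsum_eq]
  · refine tsum_congr fun l => ?_
    by_cases hl : l ∈ ascFrom r 0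
    · simp [hl, (shiftParts_injective 1).mem_set_image, partsTerm_shiftParts_one]
    · simp [hl, (shiftParts_injective 1).mem_set_image]
  · refine (Function.support_subset_iff'.2 fun x hx => Set.indicator_of_notMem ?_ _)
    exact fun h => hx (Set.image_subset_range _ _ h)

theorem partsSeries_ascFrom_shift (d : ℤ⟦X⟧) :
    (∏ c : Fin r, (1 - MvPowerSeries.C d * MvPowerSeries.X c)) *
        partsSeries primaryContent d (ascFrom r 0) =
      (∏ c : Fin r, (1 + MvPowerSeries.X c)) *
        shiftSeries r (partsSeries primaryContent d (ascFrom r 0)) := by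
  have key : ∀ m (hm : m ≤ r),
      (∏ c : Fin m, (1 - MvPowerSeries.C d * MvPowerSeries.X (Fin.castLE hm c))) *
          partsSeries primaryContent d (ascFrom r 0) =
        (∏ c : Fin m, (1 + MvPowerSeries.X (Fin.castLE hm c))) *
          partsSeries primaryContent d (ascFrom r m) := by
    intro m
    induction m with
    | zero => simp
    | succ m ih =>
      intro hm
      have h1 := ih (by omega)
      have h2 := partsSeries_ascFrom_succ d (⟨m, hm⟩ : Fin r)
      rw [Fin.prod_univ_castSucc, Fin.prod_univ_castSucc]
      have h3 : Fin.castLE hm (Fin.last m) = ⟨m, hm⟩ := rfl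
      simp only [Fin.castLE_castSucc, h3] at h1 h2 ⊢
      linear_combination (1 - MvPowerSeries.C d * MvPowerSeries.X ⟨m, hm⟩) * h1 +
        (∏ c : Fin m, (1 + MvPowerSeries.X (Fin.castLE (Nat.le_of_succ_le hm) c))) * h2
  rw [← partsSeries_ascFrom_self]
  exact key r le_rfl

theorem constantCoeff_partsSeries [Finite C] {κ : C → Fin r →₀ ℕ} (hκ : ∀ c, κ c ≠ 0)
    (d : ℤ⟦X⟧) {S : Set (List (ColouredPart C))} (hS : [] ∈ S) :
    MvPowerSeries.constantCoeff (partsSeries κ d S) = 1 := by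
  classical
  have h1 := (summable_partsTerm hκ d S).hasSum
  rw [MvPowerSeries.WithPiTopology.hasSum_iff_hasSum_coeff] at h1
  have h2 : ∀ l, l ≠ [] → MvPowerSeries.coeff 0 (S.indicator (partsTerm κ d) l) = 0 := by
    intro l hl
    cases l with
    | nil => exact absurd rfl hl
    | cons p l =>
      by_cases h : p :: l ∈ S
      · rw [Set.indicator_of_mem h, partsTerm, MvPowerSeries.coeff_monomial, if_neg]
        intro h0
        have h3 : (κ p.colour).degree ≠ 0 := by
          rw [Ne, Finsupp.degree_eq_zero_iff]
          exact hκ _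
        have h4 := congrArg Finsupp.degree h0
        simp only [colourContent, List.map_cons, List.sum_cons, map_add, map_zero] at h4
        omega
      · simp [h]
  refine ((h1 0).unique (hasSum_single [] h2)).trans ?_
  simp [hS, partsTerm_nil]

theorem partsSeries_primary (N : ℕ) :
    partsSeries primaryContent (-X ^ N) (ascFrom r 0) = strictSeries r N := by
  rw [← sub_eq_zero]
  -- At `d = -X ^ N` the factors `1 - d u_c` become `1 + q^N u_c`, so both series satisfy the
  -- equation with these `P` and `Q`; their constant terms 1 cancel in the difference.
  refine eq_zero_of_shift_eq
    (P := ∏ c : Fin r, (1 + MvPowerSeries.C (X ^ N) * MvPowerSeries.X c))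
    (Q := ∏ c : Fin r, (1 + MvPowerSeries.X c)) (by simp) (by simp) ?_ ?_
  · rw [map_sub, constantCoeff_partsSeries primaryContent_ne_zero _ (by simp [ascFrom])]
    simp [strictSeries]
  · have h1 := partsSeries_ascFrom_shift (r := r) (-X ^ N)
    have h2 := strictSeries_shift (r := r) N
    simp only [map_neg, neg_mul, sub_neg_eq_add] at h1
    rw [mul_sub, map_sub, mul_sub, h1, h2]

/-! ### Composite colours and the difference condition -/

instance CompositeColour.instFinite : Finite (CompositeColour r) :=
  Finite.of_injective (fun c => (⟨c.1, c.2.2⟩ : Fin (2 ^ r))) fun _ _ h =>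
    Subtype.ext (Fin.mk.inj_iff.1 h)

theorem CompositeColour.one_le_w (c : CompositeColour r) : 1 ≤ c.w :=
  Finset.card_pos.2 c.primaries_nonempty

theorem CompositeColour.mem_primaries {c : CompositeColour r} {k : Fin r} :
    k ∈ c.primaries ↔ Nat.testBit c.1 k = true := by
  simp [CompositeColour.primaries]

theorem CompositeColour.two_pow_z_le (c : CompositeColour r) : 2 ^ (c.z : ℕ) ≤ c.1 :=
  Nat.ge_two_pow_of_testBit (CompositeColour.mem_primaries.1 (Finset.max'_mem _ _))

theorem CompositeColour.eq_two_pow_of_w_eq_one {c : CompositeColour r} (h : c.w = 1) :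
    c.1 = 2 ^ (c.v : ℕ) := by
  refine Nat.eq_of_testBit_eq fun i => ?_
  obtain ⟨a, ha⟩ := Finset.card_eq_one.1 h
  have hv : c.v = a := by simp [CompositeColour.v, ha]
  rw [hv, Nat.testBit_two_pow]
  by_cases hi : i < r
  · have : Nat.testBit c.1 i = true ↔ (⟨i, hi⟩ : Fin r) = a := by
      have h1 := CompositeColour.mem_primaries (c := c) (k := ⟨i, hi⟩)
      rw [ha, Finset.mem_singleton] at h1
      exact h1.symm
    rw [Bool.eq_iff_iff, this, decide_eq_true_iff, Fin.ext_iff, eq_comm]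
  · rw [Nat.testBit_lt_two_pow
      (lt_of_lt_of_le c.2.2 (Nat.pow_le_pow_right (by norm_num) (not_lt.mp hi)))]
    symm
    rw [decide_eq_false_iff_not]
    have := a.isLt
    omega

/-- Equal values force `w = 1`, no overline on `q`, and `delta = 0`. Then `q` has a primary colour
not above the largest one in `p`, and a power of two occurring in the index of `p` is at most that
index. Hence the chain condition alone makes a list an overpartition. -/
theorem DifferenceCondition.ascRel {p q : ColouredPart (CompositeColour r)}
    (h : DifferenceCondition p q) : AscRel q p := by
  have hw := q.colour.one_le_w
  simp only [DifferenceCondition, ColouredPart.chi, CompositeColour.delta] at h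
  constructor
  · by_cases hv : p.value = q.value
    · refine Or.inr ⟨hv.symm, ?_⟩
      have hw1 : q.colour.w = 1 := by
        split_ifs at h <;> omega
      have hz : ¬ p.colour.z < q.colour.v := fun hz => by
        rw [if_pos hz] at h
        split_ifs at h <;> omega
      change q.colour.1 ≤ p.colour.1
      rw [CompositeColour.eq_two_pow_of_w_eq_one hw1]
      exact (Nat.pow_le_pow_right (by norm_num) (Fin.le_def.1 (not_lt.1 hz))).trans
        p.colour.two_pow_z_le
    · left
      split_ifs at h <;> omega
  · intro hv _
    by_contra ho
    rw [Bool.not_eq_false] at ho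
    rw [if_pos ho] at h
    split_ifs at h <;> omega

theorem ascRel_trans [LinearOrder C] {a b c : ColouredPart C} (h1 : AscRel a b)
    (h2 : AscRel b c) : AscRel a c := by
  constructor
  · rcases h1.1 with h | h <;> rcases h2.1 with h' | h'
    · exact Or.inl (h.trans h')
    · exact Or.inl (h'.1 ▸ h)
    · exact Or.inl (h.1 ▸ h')
    · exact Or.inr ⟨h.1.trans h'.1, h.2.trans h'.2⟩
  · intro hv hc
    rcases h1.1 with h | h <;> rcases h2.1 with h' | h'
    · omega
    · omega
    · omega
    · have : b.colour = a.colour := le_antisymm (hc ▸ h'.2) h.2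
      exact h1.2 h.1.symm this

theorem isOverpartition_of_isChain {l : List (ColouredPart (CompositeColour r))}
    (h : l.IsChain DifferenceCondition) : IsOverpartition l := by
  rw [isOverpartition_iff_reverse, List.pairwise_reverse]
  have : IsTrans _ fun p q : ColouredPart (CompositeColour r) => AscRel q p :=
    ⟨fun _ _ _ h1 h2 => ascRel_trans h2 h1⟩
  exact (h.imp fun _ _ h => h.ascRel).pairwise

/-! ### Chains with a prescribed sequence of colours -/

/-- Lists of composite parts, smallest part first, that satisfy the difference condition. -/
def compositeChains (r : ℕ) : Set (List (ColouredPart (CompositeColour r))) :=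
  {l | l.IsChain fun q p => DifferenceCondition p q}

noncomputable def compositeContent (c : CompositeColour r) : Fin r →₀ ℕ :=
  ∑ i ∈ c.primaries, Finsupp.single i 1

theorem compositeContent_ne_zero (c : CompositeColour r) : compositeContent c ≠ 0 := by
  intro h
  obtain ⟨i, hi⟩ := c.primaries_nonempty
  have := DFunLike.congr_fun h i
  simp [compositeContent, Finsupp.finsetSum_apply, Finsupp.single_apply, hi] at this

/-- The minimal gap between a part of colour `b` that is not overlined and the next larger part, if
the colours of the larger parts are `c`. -/
def blockGap (b : CompositeColour r) (c : List (CompositeColour r)) : ℕ :=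
  b.w - 1 + c.head?.elim 0 fun a => if a.z < b.v then 1 else 0

def chainsOfColours (c : List (CompositeColour r)) :
    Set (List (ColouredPart (CompositeColour r))) :=
  {l | l ∈ compositeChains r ∧ l.map ColouredPart.colour = c}

theorem shiftParts_mem_compositeChains {t : ℕ} {l : List (ColouredPart (CompositeColour r))} :
    shiftParts t l ∈ compositeChains r ↔ l ∈ compositeChains r := by
  change List.IsChain _ (List.map _ _) ↔ List.IsChain _ _
  rw [List.isChain_map]
  refine List.IsChain.iff fun q p => ?_
  simp [DifferenceCondition, ColouredPart.chi]

theorem shiftParts_mem_chainsOfColours {t : ℕ} {l : List (ColouredPart (CompositeColour r))}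
    {c : List (CompositeColour r)} :
    shiftParts t l ∈ chainsOfColours c ↔ l ∈ chainsOfColours c := by
  change _ ∧ _ ↔ _ ∧ _
  rw [shiftParts_mem_compositeChains, shiftParts, List.map_map]
  rfl

theorem le_value_of_mem {q : ColouredPart (CompositeColour r)}
    {l : List (ColouredPart (CompositeColour r))} (h : q :: l ∈ compositeChains r) :
    ∀ p ∈ q :: l, q.value ≤ p.value := by
  have h1 : (q :: l).IsChain fun q p => q.value ≤ p.value := by
    refine List.IsChain.imp (fun a b hab => ?_) h
    rcases hab.ascRel.1 with h | h <;> omega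
  have : IsTrans _ fun q p : ColouredPart (CompositeColour r) => q.value ≤ p.value :=
    ⟨fun _ _ _ h1 h2 => h1.trans h2⟩
  intro p hp
  rcases List.mem_cons.1 hp with rfl | hp
  · exact le_rfl
  · exact (List.pairwise_cons.1 h1.pairwise).1 p hp

theorem cons_shiftParts_mem_chainsOfColours (b : CompositeColour r) (o : Bool)
    (c : List (CompositeColour r)) {l : List (ColouredPart (CompositeColour r))} :
    ⟨0, b, o⟩ :: l ∈ chainsOfColours (b :: c) ↔
      ∃ l' ∈ chainsOfColours c, l = shiftParts (blockGap b c + o.toNat) l' := by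
  have hw := b.one_le_w
  have key : ∀ p : ColouredPart (CompositeColour r), ∀ c',
      DifferenceCondition p ⟨0, b, o⟩ ↔ blockGap b (p.colour :: c') + o.toNat ≤ p.value := by
    intro p c'
    simp only [DifferenceCondition, blockGap, CompositeColour.delta, ColouredPart.chi,
      List.head?_cons, Option.elim_some]
    cases o <;> split_ifs <;> simp at * <;> omega
  change List.IsChain _ _ ∧ _ ↔ _
  rw [List.isChain_cons, List.map_cons, List.cons.injEq]
  constructor
  · rintro ⟨⟨h1, h2⟩, -, h3⟩
    have h4 : ∀ p ∈ l, blockGap b c + o.toNat ≤ p.value := by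
      cases l with
      | nil => simp
      | cons p l =>
        intro p' hp'
        have h5 := (key p (l.map ColouredPart.colour)).1 (h1 p rfl)
        rw [List.map_cons] at h3
        rw [h3] at h5
        exact h5.trans (le_value_of_mem h2 p' hp')
    obtain ⟨l', rfl⟩ := exists_shiftParts_eq h4
    exact ⟨l', shiftParts_mem_chainsOfColours.1 ⟨h2, h3⟩, rfl⟩
  · rintro ⟨l', hl', rfl⟩
    have h := (shiftParts_mem_chainsOfColours (t := blockGap b c + o.toNat)).2 hl'
    refine ⟨⟨?_, h.1⟩, rfl, h.2⟩
    intro y hy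
    cases l' with
    | nil => simp [shiftParts] at hy
    | cons p l' =>
      obtain rfl : _ = y := by simpa [shiftParts] using hy
      rw [key _ (l'.map ColouredPart.colour)]
      have : p.colour :: l'.map ColouredPart.colour = c := hl'.2
      simp [this]

/-- Either all values are positive and can be lowered by 1, or the smallest value is 0 and the
larger parts form an arbitrary chain raised by the minimal gap, which an overline increases by 1. -/
theorem chainsOfColours_cons (b : CompositeColour r) (c : List (CompositeColour r)) :
    chainsOfColours (b :: c) = shiftParts 1 '' chainsOfColours (b :: c) ∪
      ((fun l => ⟨0, b, false⟩ :: shiftParts (blockGap b c) l) '' chainsOfColours c ∪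
        (fun l => ⟨0, b, true⟩ :: shiftParts (blockGap b c + 1) l) '' chainsOfColours c) := by
  ext l
  simp only [Set.mem_union, Set.mem_image]
  constructor
  · intro h
    cases l with
    | nil => simp [chainsOfColours] at h
    | cons q l =>
      by_cases hq : q.value = 0
      · obtain ⟨v, b', o⟩ := q
        obtain rfl : v = 0 := hq
        obtain rfl : b' = b := by simpa using congrArg List.head? h.2
        rw [cons_shiftParts_mem_chainsOfColours] at h
        obtain ⟨l', hl', rfl⟩ := h
        right
        cases o with
        | false => exact Or.inl ⟨l', hl', rfl⟩
        | true => exact Or.inr ⟨l', hl', rfl⟩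
      · obtain ⟨l', hl'⟩ := exists_shiftParts_eq (t := 1) fun p hp =>
          (Nat.one_le_iff_ne_zero.2 hq).trans (le_value_of_mem h.1 p hp)
        exact Or.inl ⟨l', shiftParts_mem_chainsOfColours.1 (hl' ▸ h), hl'⟩
  · rintro (⟨l, h, rfl⟩ | ⟨l, h, rfl⟩ | ⟨l, h, rfl⟩)
    · exact shiftParts_mem_chainsOfColours.2 h
    · exact (cons_shiftParts_mem_chainsOfColours b false c).2 ⟨l, h, rfl⟩
    · exact (cons_shiftParts_mem_chainsOfColours b true c).2 ⟨l, h, rfl⟩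

theorem partsSeries_chainsOfColours_cons (d : ℤ⟦X⟧) (b : CompositeColour r)
    (c : List (CompositeColour r)) :
    (1 - MvPowerSeries.C (X ^ (c.length + 1))) *
        partsSeries compositeContent d (chainsOfColours (b :: c)) =
      MvPowerSeries.monomial (compositeContent b)
        ((d + X ^ c.length) * X ^ (c.length * blockGap b c)) *
        partsSeries compositeContent d (chainsOfColours c) := by
  have hlen : ∀ c, ∀ l ∈ chainsOfColours (r := r) c, l.length = c.length := by
    rintro c l ⟨-, rfl⟩
    simp
  have hd1 : Disjoint
      ((fun l => ⟨0, b, false⟩ :: shiftParts (blockGap b c) l) '' chainsOfColours c)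
      ((fun l => ⟨0, b, true⟩ :: shiftParts (blockGap b c + 1) l) '' chainsOfColours c) := by
    rw [Set.disjoint_left]
    rintro _ ⟨l, -, rfl⟩ ⟨l', -, h⟩
    simp at h
  have hd2 : Disjoint (shiftParts 1 '' chainsOfColours (b :: c))
      ((fun l => ⟨0, b, false⟩ :: shiftParts (blockGap b c) l) '' chainsOfColours c ∪
        (fun l => ⟨0, b, true⟩ :: shiftParts (blockGap b c + 1) l) '' chainsOfColours c) := by
    rw [Set.disjoint_left]
    rintro _ ⟨l, -, rfl⟩ (⟨l', -, h⟩ | ⟨l', -, h⟩) <;>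
    · have h' := congrArg (fun l => (l.map ColouredPart.value).head?) h
      cases l <;> simp [shiftParts] at h'
  have hinj : ∀ o t, Function.Injective fun l => (⟨0, b, o⟩ : ColouredPart (CompositeColour r)) ::
      shiftParts t l := fun o t => List.cons_injective.comp (shiftParts_injective t)
  have e := congrArg (partsSeries compositeContent d) (chainsOfColours_cons b c)
  rw [partsSeries_union compositeContent_ne_zero d hd2,
    partsSeries_union compositeContent_ne_zero d hd1,
    partsSeries_image compositeContent_ne_zero d (shiftParts_injective 1)
      (MvPowerSeries.C (X ^ (c.length + 1)))
      (fun l hl => by rw [partsTerm_shiftParts, hlen _ l hl, one_mul, List.length_cons]),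
    partsSeries_image compositeContent_ne_zero d (hinj _ _)
      (MvPowerSeries.monomial (compositeContent b) (d * X ^ (c.length * blockGap b c)))
      (fun l hl => ?_),
    partsSeries_image compositeContent_ne_zero d (hinj _ _)
      (MvPowerSeries.monomial (compositeContent b) (X ^ c.length * X ^ (c.length * blockGap b c)))
      (fun l hl => ?_)] at e
  · rw [add_mul, map_add]
    linear_combination e
  all_goals
    rw [partsTerm_cons, partsTerm_shiftParts, hlen _ l hl, ← mul_assoc,
      ← MvPowerSeries.monomial_zero_eq_C_apply, MvPowerSeries.monomial_mul_monomial, add_zero]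
    congr 2
    simp only [if_true, Bool.false_eq_true, if_false, pow_zero, mul_one, one_mul]
    ring

/-! ### Subset generating functions and the specialisation `d = -q^N` -/

/-- The generating function of the `s`-element sets of natural numbers less than `N`. -/
noncomputable def subsetSeries : ℕ → ℕ → ℤ⟦X⟧
  | 0, _ => 1
  | _ + 1, 0 => 0
  | s + 1, N + 1 => subsetSeries (s + 1) N + X ^ N * subsetSeries s N

theorem subsetSeries_zero (N : ℕ) : subsetSeries 0 N = 1 := by
  rw [subsetSeries]

theorem subsetSeries_succ_zero (s : ℕ) : subsetSeries (s + 1) 0 = 0 := by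
  rw [subsetSeries]

theorem subsetSeries_succ_succ (s N : ℕ) :
    subsetSeries (s + 1) (N + 1) = subsetSeries (s + 1) N + X ^ N * subsetSeries s N := by
  rw [subsetSeries]

/-- The second Pascal rule: where the definition splits on the largest possible element, this splits
on whether 0 belongs to the set, the other elements being lowered by 1. -/
theorem subsetSeries_succ_succ' (s N : ℕ) : subsetSeries (s + 1) (N + 1) =
    X ^ (s + 1) * subsetSeries (s + 1) N + X ^ s * subsetSeries s N := by
  induction N generalizing s with
  | zero =>
    rw [subsetSeries_succ_succ, subsetSeries_succ_zero]
    cases s <;> simp [subsetSeries_zero, subsetSeries_succ_zero]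
  | succ N ih =>
    cases s with
    | zero =>
      have h1 := ih 0
      have h2 := subsetSeries_succ_succ 0 N
      have h3 := subsetSeries_succ_succ 0 (N + 1)
      simp only [subsetSeries_zero] at h1 h2 h3 ⊢
      linear_combination h3 + h1 - X * h2
    | succ s =>
      have h1 := ih s
      have h2 := ih (s + 1)
      have h3 := subsetSeries_succ_succ (s + 1) N
      have h4 := subsetSeries_succ_succ s N
      have h5 := subsetSeries_succ_succ (s + 1) (N + 1)
      linear_combination h5 + h2 + X ^ (N + 1) * h1 - X ^ (s + 2) * h3 - X ^ (s + 1) * h4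

/-- The difference of the two Pascal rules. The factor `X ^ s - X ^ N` is `d + q^s` at `d = -q^N`,
as in the chain recursion. -/
theorem one_sub_mul_subsetSeries (s N : ℕ) :
    (1 - X ^ (s + 1)) * subsetSeries (s + 1) N = (X ^ s - X ^ N) * subsetSeries s N := by
  have h1 := subsetSeries_succ_succ s N
  have h2 := subsetSeries_succ_succ' s N
  linear_combination h2 - h1

/-- The gap above a part raises every larger part, hence the factor `c.length`. -/
def blockWeight : List (CompositeColour r) → ℕ
  | [] => 0
  | b :: c => blockWeight c + c.length * blockGap b c

theorem partsSeries_chainsOfColours (N : ℕ) (c : List (CompositeColour r)) :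
    partsSeries compositeContent (-X ^ N) (chainsOfColours c) =
      MvPowerSeries.monomial (c.map compositeContent).sum
        (X ^ blockWeight c * subsetSeries c.length N) := by
  induction c with
  | nil =>
    have : chainsOfColours (r := r) [] = {[]} := by
      ext l
      simp only [chainsOfColours, List.map_eq_nil_iff, Set.mem_singleton_iff, Set.mem_ofPred_eq]
      refine ⟨fun h => h.2, fun h => ⟨?_, h⟩⟩
      rw [h]
      exact List.isChain_nil
    rw [partsSeries, this, tsum_eq_single []]
    · simp [partsTerm_nil, blockWeight, subsetSeries_zero]
    · intro l hl
      simp [hl]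
  | cons b c ih =>
    have h0 : (1 - MvPowerSeries.C (X ^ (c.length + 1)) : ColourSeries r) ≠ 0 := by
      intro h
      have := congrArg (fun f => PowerSeries.constantCoeff (MvPowerSeries.constantCoeff f)) h
      simp at this
    refine mul_left_cancel₀ h0 ?_
    rw [partsSeries_chainsOfColours_cons, ih, sub_mul, one_mul,
      ← MvPowerSeries.monomial_zero_eq_C_apply, MvPowerSeries.monomial_mul_monomial,
      MvPowerSeries.monomial_mul_monomial, zero_add, ← map_sub, List.map_cons, List.sum_cons,
      List.length_cons, blockWeight]
    congr 1
    have := one_sub_mul_subsetSeries c.length N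
    rw [pow_add]
    linear_combination -X ^ blockWeight c * X ^ (c.length * blockGap b c) * this

theorem hasSum_compositeChains (N : ℕ) :
    HasSum (fun c : List (CompositeColour r) =>
      MvPowerSeries.monomial (c.map compositeContent).sum
        (X ^ blockWeight c * subsetSeries c.length N))
      (partsSeries compositeContent (-X ^ N) (compositeChains r)) := by
  have h := (summable_partsTerm compositeContent_ne_zero (-X ^ N)
    (compositeChains r)).hasSum.tsum_fiberwise (List.map ColouredPart.colour)
  refine HasSum.congr_fun h fun c => ?_
  rw [← partsSeries_chainsOfColours, partsSeries, tsum_subtype, Set.indicator_indicator]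
  congr! 3
  exact Set.inter_comm _ _

/-! ### Words in the primary colours and their cuts into decreasing blocks -/

theorem CompositeColour.primaries_injective :
    Function.Injective (CompositeColour.primaries (r := r)) := by
  intro c d h
  refine Subtype.ext (Nat.eq_of_testBit_eq fun i => ?_)
  by_cases hi : i < r
  · rw [Bool.eq_iff_iff, ← CompositeColour.mem_primaries (k := ⟨i, hi⟩), h,
      CompositeColour.mem_primaries]
  · have h2 : 2 ^ r ≤ 2 ^ i := Nat.pow_le_pow_right (by norm_num) (not_lt.mp hi)
    rw [Nat.testBit_lt_two_pow (c.2.2.trans_le h2), Nat.testBit_lt_two_pow (d.2.2.trans_le h2)]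

theorem CompositeColour.exists_primaries_eq {s : Finset (Fin r)} (hs : s.Nonempty) :
    ∃ c : CompositeColour r, c.primaries = s := by
  have h (k : Fin r) : (Nat.ofBits fun k : Fin r => decide (k ∈ s)).testBit k = true ↔ k ∈ s := by
    rw [Nat.testBit_ofBits_lt _ _ k.isLt]
    simp
  obtain ⟨k, hk⟩ := hs
  refine ⟨⟨Nat.ofBits fun k : Fin r => decide (k ∈ s), ?_, Nat.ofBits_lt_two_pow _⟩, ?_⟩
  · rw [Nat.one_le_iff_ne_zero]
    intro h0
    have := (h k).2 hk
    rw [h0, Nat.zero_testBit] at this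
    exact Bool.noConfusion this
  · ext k
    rw [CompositeColour.mem_primaries]
    exact h k

def singleBlock (a : Fin r) : CompositeColour r :=
  ⟨2 ^ (a : ℕ), Nat.one_le_two_pow, Nat.pow_lt_pow_right (by norm_num) a.isLt⟩

theorem primaries_singleBlock (a : Fin r) : (singleBlock a).primaries = {a} := by
  ext k
  rw [CompositeColour.mem_primaries, singleBlock, Nat.testBit_two_pow, decide_eq_true_iff,
    Finset.mem_singleton, Fin.ext_iff, eq_comm]

def insertBlock (a : Fin r) (b : CompositeColour r) : CompositeColour r :=
  ⟨b.1 ||| 2 ^ (a : ℕ), b.2.1.trans Nat.left_le_or,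
    Nat.or_lt_two_pow b.2.2 (Nat.pow_lt_pow_right (by norm_num) a.isLt)⟩

theorem primaries_insertBlock (a : Fin r) (b : CompositeColour r) :
    (insertBlock a b).primaries = insert a b.primaries := by
  ext k
  rw [CompositeColour.mem_primaries, insertBlock, Nat.testBit_or, Nat.testBit_two_pow,
    Bool.or_eq_true, decide_eq_true_iff, Finset.mem_insert, Fin.ext_iff,
    CompositeColour.mem_primaries, or_comm, eq_comm (a := (a : ℕ))]

/-- Decreasing order puts `z` first and `v` last. A block thus contains `w - 1` strict descents, and
`delta` is 1 exactly when the junction with the next block is a descent, so `blockGap` counts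
descents of the word. -/
def blockLetters (b : CompositeColour r) : List (Fin r) := b.primaries.sort (· ≥ ·)

theorem blockLetters_singleBlock (a : Fin r) : blockLetters (singleBlock a) = [a] := by
  rw [blockLetters, primaries_singleBlock, Finset.sort_singleton]

theorem CompositeColour.le_z {b : CompositeColour r} {x : Fin r} (hx : x ∈ b.primaries) :
    x ≤ b.z := Finset.le_max' _ _ hx

theorem notMem_primaries_of_z_lt {a : Fin r} {b : CompositeColour r} (h : b.z < a) :
    a ∉ b.primaries := fun ha => absurd (CompositeColour.le_z ha) (not_le.2 h)

theorem blockLetters_insertBlock {a : Fin r} {b : CompositeColour r} (h : b.z < a) :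
    blockLetters (insertBlock a b) = a :: blockLetters b := by
  rw [blockLetters, primaries_insertBlock, Finset.sort_insert _
    (fun x hx => (CompositeColour.le_z hx).trans h.le) (notMem_primaries_of_z_lt h), blockLetters]

theorem z_singleBlock (a : Fin r) : (singleBlock a).z = a := by
  simp [CompositeColour.z, primaries_singleBlock]

theorem v_singleBlock (a : Fin r) : (singleBlock a).v = a := by
  simp [CompositeColour.v, primaries_singleBlock]

theorem w_singleBlock (a : Fin r) : (singleBlock a).w = 1 := by
  simp [CompositeColour.w, primaries_singleBlock]

theorem z_insertBlock {a : Fin r} {b : CompositeColour r} (h : b.z < a) :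
    (insertBlock a b).z = a := by
  refine le_antisymm (Finset.max'_le _ _ _ fun x hx => ?_) (CompositeColour.le_z ?_)
  · rw [primaries_insertBlock, Finset.mem_insert] at hx
    rcases hx with rfl | hx
    · exact le_rfl
    · exact (CompositeColour.le_z hx).trans h.le
  · rw [primaries_insertBlock]
    exact Finset.mem_insert_self _ _

theorem v_insertBlock {a : Fin r} {b : CompositeColour r} (h : b.z < a) :
    (insertBlock a b).v = b.v := by
  refine le_antisymm (Finset.min'_le _ _ ?_) (Finset.le_min' _ _ _ fun x hx => ?_)
  · rw [primaries_insertBlock]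
    exact Finset.mem_insert_of_mem (Finset.min'_mem _ _)
  · rw [primaries_insertBlock, Finset.mem_insert] at hx
    rcases hx with rfl | hx
    · exact (Finset.min'_le _ _ (Finset.max'_mem _ b.primaries_nonempty)).trans h.le
    · exact Finset.min'_le _ _ hx

theorem w_insertBlock {a : Fin r} {b : CompositeColour r} (h : b.z < a) :
    (insertBlock a b).w = b.w + 1 := by
  rw [CompositeColour.w, primaries_insertBlock,
    Finset.card_insert_of_notMem (notMem_primaries_of_z_lt h), CompositeColour.w]

/-- A composite colour is a single primary colour, or is obtained by adding its largest primary
colour to a smaller composite colour. -/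
theorem CompositeColour.eq_singleBlock_or_insertBlock (b : CompositeColour r) :
    (∃ a, b = singleBlock a) ∨ ∃ a b', b'.z < a ∧ b = insertBlock a b' := by
  have hz : b.z ∈ b.primaries := Finset.max'_mem _ _
  rcases (b.primaries.erase b.z).eq_empty_or_nonempty with h | h
  · refine Or.inl ⟨b.z, CompositeColour.primaries_injective ?_⟩
    rw [primaries_singleBlock, ← Finset.insert_erase hz, h, insert_empty_eq]
  · obtain ⟨b', hb'⟩ := CompositeColour.exists_primaries_eq h
    refine Or.inr ⟨b.z, b', ?_, CompositeColour.primaries_injective ?_⟩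
    · have h1 : b'.z ∈ b'.primaries := Finset.max'_mem _ _
      rw [hb', Finset.mem_erase] at h1
      exact lt_of_le_of_ne (CompositeColour.le_z h1.2) h1.1
    · rw [primaries_insertBlock, hb', Finset.insert_erase hz]

theorem head?_blockLetters (b : CompositeColour r) : (blockLetters b).head? = some b.z := by
  rcases b.eq_singleBlock_or_insertBlock with ⟨a, rfl⟩ | ⟨a, b, h, rfl⟩
  · simp [blockLetters_singleBlock, z_singleBlock]
  · simp [blockLetters_insertBlock h, z_insertBlock h]

def insertHead (a : Fin r) : List (CompositeColour r) → List (CompositeColour r)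
  | [] => []
  | b :: c => insertBlock a b :: c

/-- The block decompositions of a word, with every block written in decreasing order. -/
def wordBlocks (y : List (Fin r)) : Set (List (CompositeColour r)) :=
  {c | c.flatMap blockLetters = y}

theorem wordBlocks_nil : wordBlocks ([] : List (Fin r)) = {[]} := by
  ext c
  simp only [wordBlocks, Set.mem_ofPred_eq, Set.mem_singleton_iff]
  constructor
  · intro h
    cases c with
    | nil => rfl
    | cons b c =>
      have h1 := head?_blockLetters b
      rw [List.flatMap_cons, List.append_eq_nil_iff] at h
      simp [h.1] at h1
  · rintro rfl
    rfl

theorem head?_flatMap_blockLetters (c : List (CompositeColour r)) :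
    (c.flatMap blockLetters).head? = c.head?.map CompositeColour.z := by
  cases c with
  | nil => rfl
  | cons b c => simp [List.head?_append, head?_blockLetters]

/-- Whether the word `a :: y` begins with a strict descent. -/
def StartsDescent (a : Fin r) (y : List (Fin r)) : Prop := ∃ x ∈ y.head?, x < a

theorem startsDescent_iff {a : Fin r} {y : List (Fin r)} {c : List (CompositeColour r)}
    (hc : c ∈ wordBlocks y) : StartsDescent a y ↔ ∃ b ∈ c.head?, b.z < a := by
  obtain rfl : _ = y := hc
  simp [StartsDescent, head?_flatMap_blockLetters]

/-- The first letter is a block by itself or joins the block after it; the latter keeps that block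
decreasing exactly when the word starts with a descent. -/
theorem wordBlocks_cons (a : Fin r) (y : List (Fin r)) :
    wordBlocks (a :: y) = List.cons (singleBlock a) '' wordBlocks y ∪
      insertHead a '' {c | c ∈ wordBlocks y ∧ StartsDescent a y} := by
  ext c
  constructor
  · intro h
    change c.flatMap blockLetters = a :: y at h
    cases c with
    | nil => simp at h
    | cons b c =>
      rcases b.eq_singleBlock_or_insertBlock with ⟨a', rfl⟩ | ⟨a', b, hb, rfl⟩
      · rw [List.flatMap_cons, blockLetters_singleBlock, List.singleton_append,
          List.cons.injEq] at h
        obtain ⟨rfl, h⟩ := h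
        exact Or.inl ⟨c, h, rfl⟩
      · rw [List.flatMap_cons, blockLetters_insertBlock hb, List.cons_append,
          List.cons.injEq] at h
        obtain ⟨rfl, h⟩ := h
        have hc : b :: c ∈ wordBlocks y := h
        exact Or.inr ⟨b :: c, ⟨hc, (startsDescent_iff hc).2 ⟨b, rfl, hb⟩⟩, rfl⟩
  · rintro (⟨c, h, rfl⟩ | ⟨c, ⟨h, h'⟩, rfl⟩)
    · change List.flatMap _ _ = _
      rw [List.flatMap_cons, blockLetters_singleBlock, List.singleton_append]
      exact congrArg _ h
    · rw [startsDescent_iff h] at h'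
      obtain ⟨b, hb, hz⟩ := h'
      cases c with
      | nil => simp at hb
      | cons b' c =>
        obtain rfl : b' = b := by simpa using hb
        change List.flatMap _ (_ :: _) = _
        rw [List.flatMap_cons, blockLetters_insertBlock hz, List.cons_append]
        exact congrArg _ h

theorem finite_wordBlocks (y : List (Fin r)) : (wordBlocks y).Finite := by
  induction y with
  | nil => simp [wordBlocks_nil]
  | cons a y ih =>
    rw [wordBlocks_cons]
    exact (ih.image _).union ((ih.subset fun c hc => hc.1).image _)

theorem blockGap_singleBlock {a : Fin r} {y : List (Fin r)} {c : List (CompositeColour r)}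
    (hc : c ∈ wordBlocks y) [Decidable (StartsDescent a y)] :
    blockGap (singleBlock a) c = if StartsDescent a y then 1 else 0 := by
  simp only [startsDescent_iff hc, blockGap, w_singleBlock, v_singleBlock]
  cases c <;> simp

theorem blockGap_insertBlock {a : Fin r} {b : CompositeColour r} (h : b.z < a)
    (c : List (CompositeColour r)) : blockGap (insertBlock a b) c = blockGap b c + 1 := by
  have := b.one_le_w
  rw [blockGap, blockGap, w_insertBlock h, v_insertBlock h]
  omega

/-- By `wordSeries_succ_cons` this enumerates the lexicographically strictly decreasing sequences of
pairs (value below `N`, letter) that spell `y`. -/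
noncomputable def wordSeries (N : ℕ) (y : List (Fin r)) : ℤ⟦X⟧ :=
  ∑ᶠ c ∈ wordBlocks y, X ^ blockWeight c * subsetSeries c.length N

theorem wordSeries_nil (N : ℕ) : wordSeries N ([] : List (Fin r)) = 1 := by
  rw [wordSeries, wordBlocks_nil, finsum_mem_singleton]
  simp [blockWeight, subsetSeries_zero]

theorem insertHead_injOn (a : Fin r) (y : List (Fin r)) :
    Set.InjOn (insertHead a) {c | c ∈ wordBlocks y ∧ StartsDescent a y} := by
  rintro c ⟨h, h'⟩ d ⟨k, -⟩ e
  have k' := h'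
  rw [startsDescent_iff h] at h'
  rw [startsDescent_iff k] at k'
  cases c with
  | nil => simp at h'
  | cons b c =>
    cases d with
    | nil => simp at k'
    | cons b' d =>
      simp only [List.head?_cons, Option.mem_def, Option.some.injEq, exists_eq_left'] at h' k'
      simp only [insertHead, List.cons.injEq] at e
      rw [e.2, List.cons.injEq]
      refine ⟨CompositeColour.primaries_injective ?_, rfl⟩
      have := congrArg CompositeColour.primaries e.1
      rw [primaries_insertBlock, primaries_insertBlock] at this
      -- The letter `a` exceeds all letters of both blocks, so erasing it recovers each of them.
      rw [← Finset.erase_insert (notMem_primaries_of_z_lt h'), this,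
        Finset.erase_insert (notMem_primaries_of_z_lt k')]

theorem wordSeries_cons_of_not {a : Fin r} {y : List (Fin r)} (h : ¬ StartsDescent a y) (N : ℕ) :
    wordSeries N (a :: y) =
      ∑ᶠ c ∈ wordBlocks y, X ^ blockWeight c * subsetSeries (c.length + 1) N := by
  classical
  have : {c | c ∈ wordBlocks y ∧ StartsDescent a y} = ∅ := by
    simp [h]
  rw [wordSeries, wordBlocks_cons, this, Set.image_empty, Set.union_empty,
    finsum_mem_image List.cons_injective.injOn]
  refine finsum_mem_congr rfl fun c hc => ?_
  rw [blockWeight, blockGap_singleBlock hc, if_neg h, List.length_cons, mul_zero, add_zero]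

/-- As a new block, `a` has gap 1 and raises all `c.length` later blocks. Joined to the first block,
it increases that block's gap by 1 and raises only the `c.length - 1` blocks behind it; a descent
makes `c` nonempty, so the subtraction is not truncated. -/
theorem wordSeries_cons_of_startsDescent {a : Fin r} {y : List (Fin r)} (h : StartsDescent a y)
    (N : ℕ) :
    wordSeries N (a :: y) = ∑ᶠ c ∈ wordBlocks y, X ^ blockWeight c *
      (X ^ c.length * subsetSeries (c.length + 1) N +
        X ^ (c.length - 1) * subsetSeries c.length N) := by
  classical
  have hfin := finite_wordBlocks y
  have hset : {c | c ∈ wordBlocks y ∧ StartsDescent a y} = wordBlocks y := by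
    simp [h]
  have hdisj : Disjoint (List.cons (singleBlock a) '' wordBlocks y)
      (insertHead a '' {c | c ∈ wordBlocks y ∧ StartsDescent a y}) := by
    rw [Set.disjoint_left]
    rintro _ ⟨c, -, rfl⟩ ⟨d, ⟨hd, hd'⟩, e⟩
    rw [startsDescent_iff hd] at hd'
    cases d with
    | nil => simp at hd'
    | cons b d =>
      simp only [List.head?_cons, Option.mem_def, Option.some.injEq, exists_eq_left'] at hd'
      simp only [insertHead, List.cons.injEq] at e
      have h1 := congrArg CompositeColour.w e.1
      have h2 := b.one_le_w
      rw [w_insertBlock hd', w_singleBlock] at h1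
      omega
  rw [wordSeries, wordBlocks_cons, finsum_mem_union hdisj (hfin.image _)
    ((hset ▸ hfin).image _), finsum_mem_image List.cons_injective.injOn,
    finsum_mem_image (insertHead_injOn a y), hset, ← finsum_mem_add_distrib hfin]
  refine finsum_mem_congr rfl fun c hc => ?_
  rw [blockWeight, blockGap_singleBlock hc, if_pos h, mul_add]
  congr 1
  · rw [List.length_cons]
    ring
  · have h' := (startsDescent_iff hc).1 h
    cases c with
    | nil => simp at h'
    | cons b c =>
      simp only [List.head?_cons, Option.mem_def, Option.some.injEq, exists_eq_left'] at h'
      simp only [insertHead, blockWeight, blockGap_insertBlock h', List.length_cons,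
        Nat.add_sub_cancel]
      ring

theorem wordSeries_zero_cons (a : Fin r) (y : List (Fin r)) : wordSeries 0 (a :: y) = 0 := by
  refine finsum_mem_eq_zero_of_forall_eq_zero fun c hc => ?_
  cases c with
  | nil => simp [wordBlocks] at hc
  | cons b c => rw [List.length_cons, subsetSeries_succ_zero, mul_zero]

/-- The new term is the case where the first letter has value `N`: the next letter may share this
value only if it is smaller. -/
theorem wordSeries_succ_cons (N : ℕ) (a : Fin r) (y : List (Fin r))
    [Decidable (StartsDescent a y)] :
    wordSeries (N + 1) (a :: y) = wordSeries N (a :: y) +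
      X ^ N * wordSeries (if StartsDescent a y then N + 1 else N) y := by
  have hfin := finite_wordBlocks y
  split_ifs with h
  · rw [wordSeries_cons_of_startsDescent h, wordSeries_cons_of_startsDescent h, wordSeries,
      mul_finsum_mem' _ _ hfin, ← finsum_mem_add_distrib hfin]
    refine finsum_mem_congr rfl fun c hc => ?_
    have h' := (startsDescent_iff hc).1 h
    cases c with
    | nil => simp at h'
    | cons b c =>
      simp only [List.length_cons, Nat.add_sub_cancel]
      -- Both Pascal rules are needed: the two placements of `a` combine into a single subset series
      -- with bound `N + 1`.
      rw [subsetSeries_succ_succ (c.length + 1), subsetSeries_succ_succ' c.length]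
      have h1 := subsetSeries_succ_succ c.length N
      rw [subsetSeries_succ_succ' c.length] at h1
      linear_combination X ^ blockWeight (b :: c) * X ^ c.length * h1
  · rw [wordSeries_cons_of_not h, wordSeries_cons_of_not h, wordSeries,
      mul_finsum_mem' _ _ hfin, ← finsum_mem_add_distrib hfin]
    refine finsum_mem_congr rfl fun c hc => ?_
    rw [subsetSeries_succ_succ]
    ring

/-! ### Summing over all words -/

noncomputable def wordContent (y : List (Fin r)) : Fin r →₀ ℕ := (y.map primaryContent).sum

theorem sum_compositeContent {y : List (Fin r)} {c : List (CompositeColour r)}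
    (hc : c ∈ wordBlocks y) : (c.map compositeContent).sum = wordContent y := by
  obtain rfl : _ = y := hc
  induction c with
  | nil => simp [wordContent]
  | cons b c ih =>
    rw [List.map_cons, List.sum_cons, ih, wordContent, wordContent, List.flatMap_cons,
      List.map_append, List.sum_append]
    congr 1
    rw [compositeContent, blockLetters, Finset.sum_eq_multiset_sum,
      ← Finset.sort_eq b.primaries (· ≥ ·), Multiset.map_coe, Multiset.sum_coe]
    rfl

theorem hasSum_words (N : ℕ) :
    HasSum (fun y : List (Fin r) => MvPowerSeries.monomial (wordContent y) (wordSeries N y))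
      (partsSeries compositeContent (-X ^ N) (compositeChains r)) := by
  have h := (hasSum_compositeChains (r := r) N).tsum_fiberwise (List.flatMap blockLetters)
  refine HasSum.congr_fun h fun y => ?_
  have hfin := finite_wordBlocks y
  have hfin' : Finite (List.flatMap blockLetters ⁻¹' {y} : Set (List (CompositeColour r))) := hfin
  rw [tsum_eq_finsum (Set.toFinite _), finsum_set_coe_eq_finsum_mem
    (f := fun c : List (CompositeColour r) => MvPowerSeries.monomial (c.map compositeContent).sum
      (X ^ blockWeight c * subsetSeries c.length N))]
  refine ((MvPowerSeries.monomial (wordContent y)).toAddMonoidHom.map_finsum_mem _ hfin).trans ?_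
  refine finsum_mem_congr rfl fun c hc => ?_
  rw [sum_compositeContent hc]
  rfl

theorem degree_wordContent (y : List (Fin r)) : (wordContent y).degree = y.length := by
  induction y with
  | nil => simp [wordContent]
  | cons a y ih =>
    simp only [wordContent, List.map_cons, List.sum_cons, map_add, List.length_cons] at ih ⊢
    rw [ih, primaryContent, Finsupp.degree_single, add_comm]

theorem summable_words (f : List (Fin r) → ℤ⟦X⟧) :
    Summable fun y => MvPowerSeries.monomial (wordContent y) (f y) := by
  classical
  refine ColourSeries.summable_of_finite fun ℓ n =>
    (List.finite_length_le (Fin r) ℓ.degree).subset fun y hy => ?_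
  by_contra h
  refine hy ?_
  rw [MvPowerSeries.coeff_monomial, if_neg, map_zero]
  rintro rfl
  exact h (degree_wordContent y).ge

/-- The generating function of the strictly decreasing sequences of pairs of a value and a letter
that spell the given word and are less than the pair `(N, c)`. -/
noncomputable def wordSeriesBelow (N c : ℕ) : List (Fin r) → ℤ⟦X⟧
  | [] => 1
  | a :: y => if (a : ℕ) < c then wordSeries (N + 1) (a :: y) else wordSeries N (a :: y)

theorem wordSeriesBelow_zero (N : ℕ) (y : List (Fin r)) :
    wordSeriesBelow N 0 y = wordSeries N y := by
  cases y <;> simp [wordSeriesBelow, wordSeries_nil]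

theorem wordSeriesBelow_self (N : ℕ) (y : List (Fin r)) :
    wordSeriesBelow N r y = wordSeries (N + 1) y := by
  cases y <;> simp [wordSeriesBelow, wordSeries_nil]

theorem wordSeriesBelow_succ_cons (N : ℕ) (c : Fin r) (y : List (Fin r)) :
    wordSeriesBelow N (c + 1) (c :: y) =
      wordSeriesBelow N c (c :: y) + X ^ N * wordSeriesBelow N c y := by
  classical
  rw [wordSeriesBelow, wordSeriesBelow, if_pos (Nat.lt_succ_self _), if_neg (lt_irrefl _),
    wordSeries_succ_cons]
  congr 2
  cases y with
  | nil => rw [wordSeriesBelow, wordSeries_nil]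
  | cons x y => simp only [wordSeriesBelow, StartsDescent, List.head?_cons, Option.mem_def,
      Option.some.injEq, exists_eq_left', Fin.lt_def]; split_ifs <;> rfl

/-- Raising the bound past `(N, c)` only adds sequences that begin with this pair, and what follows
is an arbitrary sequence below it. Admitting the pairs one at a time builds the product factor by
factor. -/
theorem tsum_wordSeriesBelow_succ (N : ℕ) (c : Fin r) :
    ∑' y : List (Fin r), MvPowerSeries.monomial (wordContent y) (wordSeriesBelow N (c + 1) y) =
      (1 + MvPowerSeries.C (X ^ N) * MvPowerSeries.X c) *
        ∑' y : List (Fin r), MvPowerSeries.monomial (wordContent y) (wordSeriesBelow N c y) := by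
  rw [one_add_mul, ← sub_eq_iff_eq_add', ← (summable_words _).tsum_sub (summable_words _),
    ← (summable_words _).tsum_mul_left]
  rw [← (List.cons_injective (a := c)).tsum_eq]
  · refine tsum_congr fun y => ?_
    rw [wordSeriesBelow_succ_cons, ← map_sub, add_sub_cancel_left, MvPowerSeries.X,
      ← MvPowerSeries.monomial_zero_eq_C_apply, MvPowerSeries.monomial_mul_monomial,
      MvPowerSeries.monomial_mul_monomial, zero_add, mul_one]
    rfl
  · refine Function.support_subset_iff'.2 fun y hy => ?_
    rw [← map_sub]
    cases y with
    | nil => simp [wordSeriesBelow]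
    | cons a y =>
      have h : (a : ℕ) ≠ c := fun h => hy ⟨y, by rw [Fin.ext h]⟩
      have h' : (a : ℕ) < c + 1 ↔ (a : ℕ) < c := by omega
      simp [wordSeriesBelow, h']

theorem tsum_wordSeries_succ (N : ℕ) :
    ∑' y : List (Fin r), MvPowerSeries.monomial (wordContent y) (wordSeries (N + 1) y) =
      (∏ c : Fin r, (1 + MvPowerSeries.C (X ^ N) * MvPowerSeries.X c)) *
        ∑' y : List (Fin r), MvPowerSeries.monomial (wordContent y) (wordSeries N y) := by
  have key : ∀ m (hm : m ≤ r),
      ∑' y : List (Fin r), MvPowerSeries.monomial (wordContent y) (wordSeriesBelow N m y) =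
        (∏ c : Fin m, (1 + MvPowerSeries.C (X ^ N) * MvPowerSeries.X (Fin.castLE hm c))) *
          ∑' y : List (Fin r), MvPowerSeries.monomial (wordContent y) (wordSeries N y) := by
    intro m
    induction m with
    | zero => simp [wordSeriesBelow_zero]
    | succ m ih =>
      intro hm
      have h1 := tsum_wordSeriesBelow_succ N (⟨m, hm⟩ : Fin r)
      rw [ih (by omega)] at h1
      rw [h1, Fin.prod_univ_castSucc, ← mul_assoc,
        mul_comm (1 + MvPowerSeries.C (X ^ N) * MvPowerSeries.X (⟨m, hm⟩ : Fin r))]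
      rfl
  have h := key r le_rfl
  simp only [wordSeriesBelow_self] at h
  exact h

theorem tsum_wordSeries (N : ℕ) :
    ∑' y : List (Fin r), MvPowerSeries.monomial (wordContent y) (wordSeries N y) =
      strictSeries r N := by
  induction N with
  | zero =>
    rw [tsum_eq_single []]
    · simp [wordSeries_nil, wordContent, strictSeries]
    · intro y hy
      cases y with
      | nil => exact absurd rfl hy
      | cons a y => rw [wordSeries_zero_cons, map_zero]
  | succ N ih =>
    rw [tsum_wordSeries_succ, ih, mul_comm, strictSeries, strictSeries, Finset.prod_range_succ]

theorem partsSeries_composite (N : ℕ) :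
    partsSeries compositeContent (-X ^ N) (compositeChains r) = strictSeries r N := by
  rw [← tsum_wordSeries, (hasSum_words N).tsum_eq]

/-! ### From the series back to the refined counts -/

def partsWith (κ : C → Fin r →₀ ℕ) (S : Set (List (ColouredPart C))) (ℓ : Fin r →₀ ℕ) (k n : ℕ) :
    Set (List (ColouredPart C)) :=
  {l | l ∈ S ∧ colourContent κ l = ℓ ∧ nonOverlinedCount l = k ∧ partSum l = n}

theorem finite_partsWith [Finite C] {κ : C → Fin r →₀ ℕ} (hκ : ∀ c, κ c ≠ 0)
    (S : Set (List (ColouredPart C))) (ℓ : Fin r →₀ ℕ) (k n : ℕ) :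
    (partsWith κ S ℓ k n).Finite :=
  (finite_content_le hκ ℓ n).subset fun _ h => ⟨h.2.1, h.2.2.2.le⟩

/-- The number of non-overlined parts is at most the length, hence at most `ℓ.degree`, so the
expansion in `d` stops there. -/
theorem coeff_partsSeries [Finite C] {κ : C → Fin r →₀ ℕ} (hκ : ∀ c, κ c ≠ 0) (d : ℤ⟦X⟧)
    (S : Set (List (ColouredPart C))) (ℓ : Fin r →₀ ℕ) :
    MvPowerSeries.coeff ℓ (partsSeries κ d S) = ∑ k ∈ Finset.range (ℓ.degree + 1),
      d ^ k * PowerSeries.mk fun n => ((partsWith κ S ℓ k n).ncard : ℤ) := by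
  classical
  have h1 := (summable_partsTerm hκ d S).hasSum
  rw [MvPowerSeries.WithPiTopology.hasSum_iff_hasSum_coeff] at h1
  have h2 : ∀ k, HasSum (fun l => {l | l ∈ S ∧ colourContent κ l = ℓ ∧
      nonOverlinedCount l = k}.indicator (fun l => (X : ℤ⟦X⟧) ^ partSum l) l)
      (PowerSeries.mk fun n => ((partsWith κ S ℓ k n).ncard : ℤ)) := by
    intro k
    rw [PowerSeries.WithPiTopology.hasSum_iff_hasSum_coeff]
    intro n
    have hfin := finite_partsWith hκ S ℓ k n
    have e : ∀ l, PowerSeries.coeff n ({l | l ∈ S ∧ colourContent κ l = ℓ ∧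
        nonOverlinedCount l = k}.indicator (fun l => (X : ℤ⟦X⟧) ^ partSum l) l) =
        if l ∈ hfin.toFinset then 1 else 0 := by
      intro l
      simp only [Set.indicator_apply, Set.Finite.mem_toFinset, partsWith, Set.mem_ofPred_eq]
      split_ifs with h3 h4 h4
      · rw [PowerSeries.coeff_X_pow, if_pos h4.2.2.2.symm]
      · rw [PowerSeries.coeff_X_pow, if_neg fun h => h4 ⟨h3.1, h3.2.1, h3.2.2, h.symm⟩]
      · exact absurd ⟨h4.1, h4.2.1, h4.2.2.1⟩ h3
      · rw [map_zero]
    simp only [e, PowerSeries.coeff_mk]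
    have h5 : ((partsWith κ S ℓ k n).ncard : ℤ) =
        ∑ l ∈ hfin.toFinset, if l ∈ hfin.toFinset then 1 else 0 := by
      rw [Finset.sum_ite_mem, Finset.inter_self, Finset.sum_const, nsmul_one,
        Set.ncard_eq_toFinset_card _ hfin]
    rw [h5]
    exact hasSum_sum_of_ne_finset_zero fun l hl => if_neg hl
  have h3 := hasSum_sum fun k (_ : k ∈ Finset.range (ℓ.degree + 1)) => (h2 k).mul_left (d ^ k)
  refine (h1 ℓ).unique (h3.congr_fun fun l => ?_)
  by_cases hl : l ∈ S ∧ colourContent κ l = ℓ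
  · have hk : nonOverlinedCount l ∈ Finset.range (ℓ.degree + 1) := by
      rw [Finset.mem_range, Nat.lt_succ_iff, ← hl.2]
      exact List.countP_le_length.trans (length_le_degree hκ l)
    rw [Finset.sum_eq_single_of_mem _ hk, Set.indicator_of_mem hl.1, partsTerm,
      MvPowerSeries.coeff_monomial, if_pos hl.2.symm, Set.indicator_of_mem]
    · exact ⟨hl.1, hl.2, rfl⟩
    · intro k _ hne
      rw [Set.indicator_of_notMem, mul_zero]
      exact fun h => hne h.2.2.symm
  · rw [Finset.sum_eq_zero]
    · by_cases hS : l ∈ S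
      · rw [Set.indicator_of_mem hS, partsTerm, MvPowerSeries.coeff_monomial, if_neg]
        exact fun h => hl ⟨hS, h.symm⟩
      · rw [Set.indicator_of_notMem hS, map_zero]
    · intro k _
      rw [Set.indicator_of_notMem, mul_zero]
      exact fun h => hl ⟨h.1, h.2.1⟩

theorem neg_X_pow_injective : Function.Injective fun N : ℕ => (-X ^ N : ℤ⟦X⟧) := by
  intro M N h
  have h1 := congrArg (PowerSeries.coeff M) (neg_injective h)
  rw [PowerSeries.coeff_X_pow, PowerSeries.coeff_X_pow, if_pos rfl] at h1
  by_contra hne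
  rw [if_neg hne] at h1
  exact one_ne_zero h1

theorem ncard_partsWith_eq (ℓ : Fin r →₀ ℕ) (k n : ℕ) :
    (partsWith primaryContent (ascFrom r 0) ℓ k n).ncard =
      (partsWith compositeContent (compositeChains r) ℓ k n).ncard := by
  by_cases hk : k < ℓ.degree + 1
  · let P (a : ℕ → ℤ⟦X⟧) : Polynomial ℤ⟦X⟧ :=
      ∑ k ∈ Finset.range (ℓ.degree + 1), Polynomial.C (a k) * Polynomial.X ^ k
    have hcoeff : ∀ a, (P a).coeff k = a k := by
      intro a
      simp only [P, Polynomial.finsetSum_coeff, Polynomial.coeff_C_mul_X_pow]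
      rw [Finset.sum_ite_eq, if_pos (Finset.mem_range.2 hk)]
    have heval : ∀ a d, (P a).eval d = ∑ k ∈ Finset.range (ℓ.degree + 1), d ^ k * a k := by
      intro a d
      rw [Polynomial.eval_finsetSum]
      refine Finset.sum_congr rfl fun k _ => ?_
      rw [Polynomial.eval_C_mul, Polynomial.eval_pow, Polynomial.eval_X, mul_comm]
    have hP : P (fun k => PowerSeries.mk fun n =>
          ((partsWith primaryContent (ascFrom r 0) ℓ k n).ncard : ℤ)) =
        P fun k => PowerSeries.mk fun n =>
          ((partsWith compositeContent (compositeChains r) ℓ k n).ncard : ℤ) := by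
      -- The values `-X ^ N` are infinitely many distinct points of a domain, which determines a
      -- polynomial in `d`.
      refine Polynomial.eq_of_infinite_eval_eq _ _
        ((Set.infinite_range_of_injective neg_X_pow_injective).mono ?_)
      rintro _ ⟨N, rfl⟩
      simp only [Set.mem_ofPred_eq]
      rw [heval, heval, ← coeff_partsSeries primaryContent_ne_zero,
        ← coeff_partsSeries compositeContent_ne_zero, partsSeries_primary, partsSeries_composite]
    have h := congrArg (fun p => PowerSeries.coeff n (p.coeff k)) hP
    simp only [hcoeff, PowerSeries.coeff_mk] at h
    exact_mod_cast h
  · have : ∀ {C : Type} {κ : C → Fin r →₀ ℕ} (_ : ∀ c, κ c ≠ 0) (S : Set (List (ColouredPart C))),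
        partsWith κ S ℓ k n = ∅ := by
      intro C κ hκ S
      refine Set.eq_empty_of_forall_notMem fun l hl => hk ?_
      rw [← hl.2.1, ← hl.2.2.1]
      exact Nat.lt_succ_of_le (List.countP_le_length.trans (length_le_degree hκ l))
    rw [this primaryContent_ne_zero, this compositeContent_ne_zero, Set.ncard_empty,
      Set.ncard_empty]

theorem partSum_reverse (l : List (ColouredPart C)) : partSum l.reverse = partSum l := by
  rw [partSum, List.map_reverse, List.sum_reverse, partSum]

theorem nonOverlinedCount_reverse (l : List (ColouredPart C)) :
    nonOverlinedCount l.reverse = nonOverlinedCount l := by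
  rw [nonOverlinedCount, List.countP_reverse, nonOverlinedCount]

theorem colourContent_primary_apply (l : List (ColouredPart (Fin r))) (i : Fin r) :
    colourContent primaryContent l i = l.countP fun p => decide (p.colour = i) := by
  induction l with
  | nil => simp [colourContent]
  | cons p l ih =>
    simp only [colourContent, List.map_cons, List.sum_cons, Finsupp.add_apply,
      List.countP_cons] at ih ⊢
    rw [ih, primaryContent, Finsupp.single_apply, add_comm]
    simp

theorem colourContent_composite_apply (l : List (ColouredPart (CompositeColour r))) (i : Fin r) :
    colourContent compositeContent l i =
      l.countP fun p => decide (i ∈ p.colour.primaries) := by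
  induction l with
  | nil => simp [colourContent]
  | cons p l ih =>
    simp only [colourContent, List.map_cons, List.sum_cons, Finsupp.add_apply,
      List.countP_cons] at ih ⊢
    rw [ih, compositeContent, Finsupp.finsetSum_apply, add_comm]
    simp [Finsupp.single_apply]

theorem primaryOverpartitions_eq_image (ℓ : Fin r → ℕ) (k n : ℕ) :
    primaryOverpartitions r ℓ k n = List.reverse ''
      partsWith primaryContent (ascFrom r 0) (Finsupp.equivFunOnFinite.symm ℓ) k n := by
  ext l
  rw [Set.mem_image_iff_of_inverse List.reverse_reverse List.reverse_reverse]
  simp only [primaryOverpartitions, partsWith, ascFrom, Set.mem_ofPred_eq,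
    isOverpartition_iff_reverse, partSum_reverse, nonOverlinedCount_reverse,
    List.countP_reverse, Finsupp.ext_iff, colourContent_primary_apply, Nat.zero_le]
  simp
  tauto

theorem compositeOverpartitions_eq_image (ℓ : Fin r → ℕ) (k n : ℕ) :
    compositeOverpartitions r ℓ k n = List.reverse ''
      partsWith compositeContent (compositeChains r) (Finsupp.equivFunOnFinite.symm ℓ) k n := by
  ext l
  rw [Set.mem_image_iff_of_inverse List.reverse_reverse List.reverse_reverse]
  have h := isOverpartition_of_isChain (l := l)
  simp only [compositeOverpartitions, partsWith, compositeChains, Set.mem_ofPred_eq,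
    partSum_reverse, nonOverlinedCount_reverse, List.isChain_reverse,
    List.countP_reverse, Finsupp.ext_iff, colourContent_composite_apply]
  simp only [Finsupp.equivFunOnFinite_symm_apply_apply]
  -- The overpartition condition can be dropped and restored because the chain condition implies it.
  exact ⟨fun ⟨_, h2, h3, h4, h5⟩ => ⟨h5, h3, h4, h2⟩, fun ⟨h5, h3, h4, h2⟩ => ⟨h h5, h2, h3, h4, h5⟩⟩

theorem mainTheorem6 (r : ℕ) (hr : 0 < r) (ℓ : Fin r → ℕ) (k n : ℕ) :
    (primaryOverpartitions r ℓ k n).Finite ∧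
    (compositeOverpartitions r ℓ k n).Finite ∧
    (primaryOverpartitions r ℓ k n).ncard = (compositeOverpartitions r ℓ k n).ncard := by
  rw [primaryOverpartitions_eq_image, compositeOverpartitions_eq_image,
    Set.ncard_image_of_injective _ List.reverse_injective,
    Set.ncard_image_of_injective _ List.reverse_injective]
  exact ⟨(finite_partsWith primaryContent_ne_zero _ _ _ _).image _,
    (finite_partsWith compositeContent_ne_zero _ _ _ _).image _, ncard_partsWith_eq _ _ _⟩
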